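/- Let $K$ be a field, let $m\ge 1$ be an integer, and let $S\subseteq\mathbb N_0$ be the numerical monoid with $\mathbb N_0\setminus S=[1,m]=\{1,\dots,m\}$. Let $K[S]\subseteq K[X]$ be its monoid algebra (the polynomials all of whose exponents lie in $S$). For a domain $D$ with quotient field $F$ and a nonzero fractional ideal $I$, put $I^{-1}=(D:I)=\{x\in F\mid xI\subseteq D\}$ and $I_v=(I^{-1})^{-1}$. A fractional $v$-ideal is a fractional ideal $I$ with $I_v=I$; it is $v$-invertible if $(IJ)_v=D$ for some fractional $v$-ideal $J$. The $v$-class group $\mathcal C_v(D)$ is the group of $v$-invertible fractional $v$-ideals under $I\cdot_v J=(IJ)_v$ modulo the nonzero principal fractional ideals, and $[I]$ is the class of $I$. $\mathrm{Pic}(D)$ is the group of invertible fractional ideals modulo the nonzero principal ones; it maps canonically to $\mathcal C_v(D)$ by $[I]\mapsto[I]$. A prime divisor of $D$ is a $v$-invertible $v$-ideal that is a prime ideal of height one. Let $\mathrm{Reg}(D)$ be the set of all $a\in D$ such that every $z$ in the complete integral closure of $D$ with $za\in D$ lies in $D$. Let $\mathcal C=\{1+\sum_{i=1}^m k_iX^i\mid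 k_i\in K\}\subseteq K[X]$, a group under $\otimes$: multiply and drop all monomials of degree larger than $m$. For $f\in K[X]$ with $f(0)=1$ let $f_{\le m}\in\mathcal C$ be its truncation, obtained by dropping all monomials of degree larger than $m$. Write $\mathsf R=\mathrm{Reg}(K[S])$. 1. $\mathrm{Pic}(K[S])=\mathcal C_v(K[S])$, that is, the canonical homomorphism is bijective. Moreover, there is a group isomorphism $\phi:\mathcal C_v(K[S])\to(\mathcal C,\otimes)$ such that for every $f\in K[X]$ with $f(0)=1$ the following holds: $fK[X]\cap K[S]$ is a $v$-invertible $v$-ideal of $K[S]$, the set $fK[X]\cap\mathsf R$ is non-empty, and $\phi([I])=f_{\le m}$ for every $v$-invertible $v$-ideal $I\subseteq K[S]$ with $I\cap\mathsf R=fK[X]\cap\mathsf R$ (in particular for $I=fK[X]\cap K[S]$). 2. For this $\phi$ and every class $c\in\mathcal C_v(K[S])$, the map $f\mapsto fK[X]\cap K[S]$ is a bijection from the set of irreducible polynomials $f\in K[X]$ with $f(0)=1$ and $f_{\le m}=\phi(c)$ onto the set of prime divisors of $K[S]$ in the class $c$. 3. Every class in $\mathcal C_v(K[S])$ contains a prime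 divisor if and only if for all $a_0,\dots,a_m\in K$ with $a_0\ne0$ there is an irreducible polynomial in $K[X]$ whose coefficient at $X^i$ equals $a_i$ for all $i\in[0,m]$. Likewise, every class contains infinitely many prime divisors if and only if for all $a_0,\dots,a_m\in K$ with $a_0\neq0$ there are infinitely many such irreducible polynomials. -/

import Mathlib

open scoped nonZeroDivisors Polynomial

noncomputable section

/-! ### The `v`-operation and the `v`-class group of a domain -/

namespace VIdeal

variable {R : Type*} [CommRing R] [IsDomain R]

theorem le_inv_iff {I L : FractionalIdeal R⁰ (FractionRing R)} (hI : I ≠ 0) :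
    L ≤ I⁻¹ ↔ L * I ≤ 1 := by
  rw [FractionalIdeal.inv_eq, FractionalIdeal.le_div_iff_mul_le hI]

theorem inv_ne_zero {I : FractionalIdeal R⁰ (FractionRing R)} (hI : I ≠ 0) : I⁻¹ ≠ 0 := by
  obtain ⟨a, J, ha, rfl⟩ := FractionalIdeal.exists_eq_spanSingleton_mul I
  intro h
  have h1 : FractionalIdeal.spanSingleton R⁰ (algebraMap R (FractionRing R) a) ≤ 0 := by
    rw [← h, le_inv_iff hI, ← mul_assoc, FractionalIdeal.spanSingleton_mul_spanSingleton,
      mul_inv_cancel₀ (by simpa using ha), FractionalIdeal.spanSingleton_one, one_mul]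
    exact FractionalIdeal.coeIdeal_le_one
  have h2 := h1 (FractionalIdeal.mem_spanSingleton_self R⁰ _)
  rw [FractionalIdeal.mem_zero_iff] at h2
  exact ha (by simpa using h2)

theorem le_inv_inv (I : FractionalIdeal R⁰ (FractionRing R)) : I ≤ I⁻¹⁻¹ := by
  by_cases hI : I = 0
  · subst hI; exact bot_le
  · rw [le_inv_iff (inv_ne_zero hI), mul_comm, ← le_inv_iff hI]

theorem inv_inv_inv (I : FractionalIdeal R⁰ (FractionRing R)) : I⁻¹⁻¹⁻¹ = I⁻¹ := by
  by_cases hI : I = 0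
  · subst hI; simp [FractionalIdeal.inv_zero']
  · exact le_antisymm
      (FractionalIdeal.inv_anti_mono hI (inv_ne_zero (inv_ne_zero hI)) (le_inv_inv I))
      (le_inv_inv _)

theorem mul_ne_zero_of_ne_zero {I J : FractionalIdeal R⁰ (FractionRing R)} (hI : I ≠ 0)
    (hJ : J ≠ 0) : I * J ≠ 0 := by
  intro h
  refine hI ((FractionalIdeal.eq_zero_iff).2 fun x hx => ?_)
  by_contra hx0
  refine hJ ((FractionalIdeal.eq_zero_iff).2 fun y hy => ?_)
  have h1 := FractionalIdeal.mul_mem_mul hx hy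
  rw [h, FractionalIdeal.mem_zero_iff] at h1
  exact (mul_eq_zero.1 h1).resolve_left hx0

theorem inv_inv_mul_inv (I J : FractionalIdeal R⁰ (FractionRing R)) :
    (I⁻¹⁻¹ * J)⁻¹ = (I * J)⁻¹ := by
  by_cases hI : I = 0
  · subst hI; simp [FractionalIdeal.inv_zero']
  by_cases hJ : J = 0
  · subst hJ; simp
  have hI' := inv_ne_zero (inv_ne_zero hI)
  refine eq_of_forall_le_iff fun L => ?_
  rw [le_inv_iff (mul_ne_zero_of_ne_zero hI' hJ), le_inv_iff (mul_ne_zero_of_ne_zero hI hJ), mul_comm _ J, mul_comm _ J,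
    ← mul_assoc, ← mul_assoc, ← le_inv_iff hI', ← le_inv_iff hI, inv_inv_inv]

end VIdeal

/-- The `v`-closure `I_v = (I⁻¹)⁻¹`, where `I⁻¹ = (R : I)` for a nonzero fractional ideal `I`
(and `0_v = 0`). -/
def vClosure {R : Type*} [CommRing R] [IsDomain R] (I : FractionalIdeal R⁰ (FractionRing R)) :
    FractionalIdeal R⁰ (FractionRing R) :=
  I⁻¹⁻¹

/-- The fractional `v`-ideals of `R`: the fractional ideals `I` with `I_v = I`. -/
def FractionalVIdeal (R : Type*) [CommRing R] [IsDomain R] : Type _ :=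
  {I : FractionalIdeal R⁰ (FractionRing R) // vClosure I = I}

namespace FractionalVIdeal

variable {R : Type*} [CommRing R] [IsDomain R]

/-- The fractional ideal underlying a fractional `v`-ideal. -/
def toFractionalIdeal (I : FractionalVIdeal R) : FractionalIdeal R⁰ (FractionRing R) := I.1

@[ext] theorem ext {I J : FractionalVIdeal R}
    (h : I.toFractionalIdeal = J.toFractionalIdeal) : I = J := Subtype.ext h

/-- The fractional `v`-ideal `I_v`. -/
def ofFractionalIdeal (I : FractionalIdeal R⁰ (FractionRing R)) : FractionalVIdeal R :=
  ⟨vClosure I, VIdeal.inv_inv_inv I⁻¹⟩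

/-- `v`-multiplication `I ·_v J = (IJ)_v`. -/
instance : Mul (FractionalVIdeal R) :=
  ⟨fun I J => ofFractionalIdeal (I.toFractionalIdeal * J.toFractionalIdeal)⟩

instance : One (FractionalVIdeal R) := ⟨ofFractionalIdeal 1⟩

theorem ofFractionalIdeal_toFractionalIdeal (I : FractionalVIdeal R) :
    ofFractionalIdeal I.toFractionalIdeal = I := Subtype.ext I.2

theorem ofFractionalIdeal_mul (I J : FractionalIdeal R⁰ (FractionRing R)) :
    ofFractionalIdeal (I * J) = ofFractionalIdeal I * ofFractionalIdeal J := by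
  refine Subtype.ext ?_
  change (I * J)⁻¹⁻¹ = (I⁻¹⁻¹ * J⁻¹⁻¹)⁻¹⁻¹
  rw [VIdeal.inv_inv_mul_inv, mul_comm I, mul_comm I, VIdeal.inv_inv_mul_inv]

/-- The commutative monoid of fractional `v`-ideals under `v`-multiplication, with identity `R`. -/
instance : CommMonoid (FractionalVIdeal R) where
  mul_assoc I J L := by
    rw [← ofFractionalIdeal_toFractionalIdeal I, ← ofFractionalIdeal_toFractionalIdeal J,
      ← ofFractionalIdeal_toFractionalIdeal L]
    simp only [← ofFractionalIdeal_mul, mul_assoc]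
  one_mul I := by
    rw [← ofFractionalIdeal_toFractionalIdeal I]
    exact (ofFractionalIdeal_mul 1 _).symm.trans (by rw [one_mul])
  mul_one I := by
    rw [← ofFractionalIdeal_toFractionalIdeal I]
    exact (ofFractionalIdeal_mul _ 1).symm.trans (by rw [mul_one])
  mul_comm I J := by
    rw [← ofFractionalIdeal_toFractionalIdeal I, ← ofFractionalIdeal_toFractionalIdeal J]
    simp only [← ofFractionalIdeal_mul, mul_comm]

theorem toFractionalIdeal_one : (1 : FractionalVIdeal R).toFractionalIdeal = 1 := by
  change (1 : FractionalIdeal R⁰ (FractionRing R))⁻¹⁻¹ = 1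
  simp

/-- The homomorphism `I ↦ I_v`. -/
def ofFractionalIdealHom (R : Type*) [CommRing R] [IsDomain R] :
    FractionalIdeal R⁰ (FractionRing R) →* FractionalVIdeal R where
  toFun := ofFractionalIdeal
  map_one' := rfl
  map_mul' := ofFractionalIdeal_mul

end FractionalVIdeal

/-- The group of `v`-invertible fractional `v`-ideals of `R` under `v`-multiplication: the
fractional `v`-ideals `I` for which there is a fractional `v`-ideal `J` with `(IJ)_v = R`. -/
abbrev VInvertibleVIdeal (R : Type*) [CommRing R] [IsDomain R] : Type _ :=
  (FractionalVIdeal R)ˣ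

/-- The homomorphism from the invertible fractional ideals to the `v`-invertible fractional
`v`-ideals; it sends `I` to `I_v`, which equals `I` as `I` is invertible. -/
def invertibleToV (R : Type*) [CommRing R] [IsDomain R] :
    (FractionalIdeal R⁰ (FractionRing R))ˣ →* VInvertibleVIdeal R :=
  Units.map (FractionalVIdeal.ofFractionalIdealHom R)

theorem toFractionalIdeal_invertibleToV {R : Type*} [CommRing R] [IsDomain R]
    (I : (FractionalIdeal R⁰ (FractionRing R))ˣ) :
    (invertibleToV R I : FractionalVIdeal R).toFractionalIdeal = I := by
  change (I : FractionalIdeal R⁰ (FractionRing R))⁻¹⁻¹ = I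
  have h : ((I⁻¹ : (FractionalIdeal R⁰ (FractionRing R))ˣ) :
      FractionalIdeal R⁰ (FractionRing R)) = (I : FractionalIdeal R⁰ (FractionRing R))⁻¹ :=
    FractionalIdeal.right_inverse_eq _ _ _ I.mul_inv
  rw [← h]
  exact (FractionalIdeal.right_inverse_eq _ _ _ I.inv_mul).symm

/-- The subgroup of nonzero principal fractional ideals `aR`, `a ∈ q(R) \ {0}`. -/
def principalV (R : Type*) [CommRing R] [IsDomain R] : Subgroup (VInvertibleVIdeal R) :=
  ((toPrincipalIdeal R (FractionRing R)).range).map (invertibleToV R)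

/-- The `v`-class group `C_v(R)`: the group of `v`-invertible fractional `v`-ideals modulo the
subgroup of nonzero principal fractional ideals. -/
abbrev VClassGroup (R : Type*) [CommRing R] [IsDomain R] : Type _ :=
  VInvertibleVIdeal R ⧸ principalV R

/-- The class `[I]` of a `v`-invertible fractional `v`-ideal. -/
def VClassGroup.mk {R : Type*} [CommRing R] [IsDomain R] :
    VInvertibleVIdeal R →* VClassGroup R :=
  QuotientGroup.mk' (principalV R)

/-- The canonical homomorphism `[I] ↦ [I]` from the Picard group of the domain `R` (invertible
fractional ideals modulo nonzero principal ones) to the `v`-class group. -/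
def picToVClassGroup (R : Type*) [CommRing R] [IsDomain R] : ClassGroup R →* VClassGroup R :=
  QuotientGroup.map (toPrincipalIdeal R (FractionRing R)).range (principalV R) (invertibleToV R)
    (Subgroup.le_comap_map _ _)

/-- `J`, an ideal of `R`, is the underlying ideal of the `v`-invertible `v`-ideal `V`. -/
def VInvertibleVIdeal.IsIdeal {R : Type*} [CommRing R] [IsDomain R]
    (V : VInvertibleVIdeal R) (J : Ideal R) : Prop :=
  (V : FractionalVIdeal R).toFractionalIdeal = (J : FractionalIdeal R⁰ (FractionRing R))

/-- The prime divisors of `R` (the `v`-invertible prime `v`-ideals of height one) in the class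
`c`. -/
def primeDivisorsIn {R : Type*} [CommRing R] [IsDomain R] (c : VClassGroup R) : Set (Ideal R) :=
  {P | P.IsPrime ∧ P.height = 1 ∧ ∃ V : VInvertibleVIdeal R, V.IsIdeal P ∧ VClassGroup.mk V = c}

/-- The set `Reg(R)` of regular elements: those `a ∈ R` such that `z ∈ R` whenever `z` lies in the
complete integral closure of `R` and `za ∈ R`. -/
def regularElements (R : Type*) [CommRing R] [IsDomain R] : Set R :=
  {a | ∀ z ∈ completeIntegralClosure R (FractionRing R),
    z * algebraMap R (FractionRing R) a ∈ (algebraMap R (FractionRing R)).range →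
      z ∈ (algebraMap R (FractionRing R)).range}

/-! ### Numerical monoid algebras inside `K[X]` -/

/-- The embedding `K[S] → K[X]` of the monoid algebra of a submonoid `S` of `ℕ`, which sends the
basis element belonging to `s` to `X ^ s`. -/
def monoidAlgebraToPolynomial (K : Type*) [Field K] (S : AddSubmonoid ℕ) :
    AddMonoidAlgebra K S →ₐ[K] K[X] :=
  AddMonoidAlgebra.lift K K[X] S
    ((powersHom K[X] Polynomial.X).comp (AddMonoidHom.toMultiplicative S.subtype))

/-- The ideal `fK[X] ∩ K[S]` of `K[S]`. -/
def contractedIdeal {K : Type*} [Field K] (S : AddSubmonoid ℕ) (f : K[X]) :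
    Ideal (AddMonoidAlgebra K S) :=
  (Ideal.span {f}).comap (monoidAlgebraToPolynomial K S)

/-! ### The group of truncated polynomials -/

/-- `∑_{i ≤ m} p_i X^i`, the truncation of `p = ∑ p_i X^i`. -/
def truncatePoly {K : Type*} [Field K] (m : ℕ) (p : K[X]) : K[X] :=
  ∑ i ∈ Finset.range (m + 1), Polynomial.monomial i (p.coeff i)

theorem coeff_truncatePoly {K : Type*} [Field K] (m : ℕ) (p : K[X]) (j : ℕ) :
    (truncatePoly m p).coeff j = if j ≤ m then p.coeff j else 0 := by
  simp [truncatePoly, Polynomial.coeff_monomial]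

/-- The set `𝒞` of polynomials `1 + ∑_{i=1}^m k_i X^i` over `K`. -/
def TruncatedPoly (K : Type*) [Field K] (m : ℕ) : Type _ :=
  {p : K[X] // p.coeff 0 = 1 ∧ ∀ j, m < j → p.coeff j = 0}

namespace TruncatedPoly

variable {K : Type*} [Field K] {m : ℕ}

/-- The truncation of a polynomial with constant term `1`, as an element of `𝒞`. -/
def ofPoly (m : ℕ) (f : K[X]) (hf : f.coeff 0 = 1) : TruncatedPoly K m :=
  ⟨truncatePoly m f, by simp [coeff_truncatePoly, hf],
    fun j hj => by simp [coeff_truncatePoly, Nat.not_le.2 hj]⟩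

/-- The operation `⊗`: multiply and drop all monomials of degree larger than `m`. -/
instance : Mul (TruncatedPoly K m) :=
  ⟨fun p q => ofPoly m (p.1 * q.1) (by simp [Polynomial.mul_coeff_zero, p.2.1, q.2.1])⟩

instance : One (TruncatedPoly K m) :=
  ⟨⟨1, by simp, fun j hj => by simp [Polynomial.coeff_one, (Nat.zero_lt_of_lt hj).ne']⟩⟩

/-- The inverse: the truncation of the inverse power series. -/
instance : Inv (TruncatedPoly K m) :=
  ⟨fun p => ⟨PowerSeries.trunc (m + 1) (p.1 : PowerSeries K)⁻¹,
    by simp [PowerSeries.coeff_trunc, p.2.1],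
    fun j hj => by simp [PowerSeries.coeff_trunc]; omega⟩⟩

theorem coeff_mul (p q : TruncatedPoly K m) (j : ℕ) :
    (p * q).1.coeff j = if j ≤ m then (p.1 * q.1).coeff j else 0 :=
  coeff_truncatePoly m _ j

@[ext] theorem ext {p q : TruncatedPoly K m} (h : ∀ j ≤ m, p.1.coeff j = q.1.coeff j) :
    p = q := by
  refine Subtype.ext (Polynomial.ext fun j => ?_)
  by_cases hj : j ≤ m
  · exact h j hj
  · rw [p.2.2 j (by omega), q.2.2 j (by omega)]

instance : CommGroup (TruncatedPoly K m) where
  mul_assoc p q r := by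
    ext j hj
    have h1 : ((p * q).1 * r.1).coeff j = (p.1 * q.1 * r.1).coeff j := by
      rw [Polynomial.coeff_mul, Polynomial.coeff_mul]
      refine Finset.sum_congr rfl fun x hx => ?_
      have := Finset.HasAntidiagonal.mem_antidiagonal.1 hx
      rw [coeff_mul, if_pos (by omega)]
    have h2 : (p.1 * (q * r).1).coeff j = (p.1 * (q.1 * r.1)).coeff j := by
      rw [Polynomial.coeff_mul, Polynomial.coeff_mul]
      refine Finset.sum_congr rfl fun x hx => ?_
      have := Finset.HasAntidiagonal.mem_antidiagonal.1 hx
      rw [coeff_mul, if_pos (by omega)]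
    rw [coeff_mul, coeff_mul, if_pos hj, if_pos hj, h1, h2, mul_assoc]
  one_mul p := by
    ext j hj
    rw [coeff_mul, if_pos hj]
    exact congrArg (fun r => Polynomial.coeff r j) (one_mul p.1)
  mul_one p := by
    ext j hj
    rw [coeff_mul, if_pos hj]
    exact congrArg (fun r => Polynomial.coeff r j) (mul_one p.1)
  mul_comm p q := by
    ext j hj
    rw [coeff_mul, coeff_mul, mul_comm]
  inv_mul_cancel p := by
    ext j hj
    rw [coeff_mul, if_pos hj]
    change _ = (1 : K[X]).coeff j
    have h0 : PowerSeries.constantCoeff (p.1 : PowerSeries K) ≠ 0 := by simp [p.2.1]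
    have h : ((p.1 : PowerSeries K)⁻¹ * (p.1 : PowerSeries K)).coeff j =
        (1 : PowerSeries K).coeff j := by rw [PowerSeries.inv_mul_cancel _ h0]
    rw [PowerSeries.coeff_mul] at h
    rw [Polynomial.coeff_mul]
    rw [PowerSeries.coeff_one] at h
    rw [Polynomial.coeff_one, ← h]
    refine Finset.sum_congr rfl fun x hx => ?_
    have := Finset.HasAntidiagonal.mem_antidiagonal.1 hx
    change (PowerSeries.trunc (m + 1) (p.1 : PowerSeries K)⁻¹).coeff x.1 * _ = _
    rw [PowerSeries.coeff_trunc, if_pos (by omega), Polynomial.coeff_coe]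

end TruncatedPoly

end

/-!
The monoid algebra is `K[S] = K + X^{m+1}K[X]`. It shares its quotient field with `K[X]`, and
`X^{m+1}K[X]`, the set of elements with constant term `0`, is its conductor. Everything rests on the
ideals `I(f) = fK[X] ∩ K[S]` with `f(0) = 1`.

* An ideal that contains an element with nonzero constant term equals `I(f)` for a unique `f` with
  `f(0) = 1`: `f` generates its extension to `K[X]`, and the conductor recovers the ideal from its
  extension (`exists_eq_contractedIdeal`, `contractedIdeal_injOn`). In the same way
  `I(f)I(g) = I(fg)` (`contractedIdeal_mul`), and `I(f)` is principal iff `f ∈ K[S]`, that is, iff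
  `f ≡ 1` modulo `X^{m+1}`. As `f` is invertible modulo `X^{m+1}`, every `I(f)` is invertible, and
  its class depends only on the truncation of `f` and determines it.
* If `V` is a `v`-invertible `v`-ideal with `v`-inverse `W`, then some product `xy` with `x ∈ V` and
  `y ∈ W` has a nonzero constant term: otherwise `X · VW ⊆ K[S]`, so that `X` would lie in
  `(VW)⁻¹ = K[S]` (`exists_mul_coeff_zero_ne_zero`). Hence `yV` is an ideal of the form `I(f)`. This
  makes `V` invertible, and it makes `p ↦ [I(p)]` an isomorphism from `𝒞` onto the `v`-class group,
  the inverse of which is the isomorphism sought.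
* As `K[X]` is completely integrally closed, the regular elements are those with a nonzero constant
  term (`mem_regularElements_iff`), and an ideal that contains one is generated by them.
* A `v`-invertible prime `v`-ideal is not contained in the conductor, so it is some `I(f)`, and
  `I(f)` is prime iff `f` is irreducible; it then has height one
  (`bijOn_contractedIdeal_primeDivisorsIn`).
* Prescribing the coefficients `a₀, …, a_m` with `a₀ ≠ 0` amounts, after division by `a₀`, to
  prescribing the truncation of a polynomial with constant term `1`.
-/

/-! ### The embedding `K[S] → K[X]` -/

section Embedding

variable {K : Type*} [Field K] {S : AddSubmonoid ℕ} {m : ℕ}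

theorem monoidAlgebraToPolynomial_single (s : S) (k : K) :
    monoidAlgebraToPolynomial K S (AddMonoidAlgebra.single s k) =
      Polynomial.monomial (s : ℕ) k := by
  simp [monoidAlgebraToPolynomial, AddMonoidAlgebra.lift_single,
    ← Polynomial.C_mul_X_pow_eq_monomial, Polynomial.smul_eq_C_mul]

theorem coeff_monoidAlgebraToPolynomial (r : AddMonoidAlgebra K S) (i : ℕ) (hi : i ∈ S) :
    (monoidAlgebraToPolynomial K S r).coeff i = r.coeff ⟨i, hi⟩ := by
  induction r using AddMonoidAlgebra.induction_linear with
  | zero => simp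
  | add f g hf hg => simp [hf, hg]
  | single s k =>
    rw [monoidAlgebraToPolynomial_single, Polynomial.coeff_monomial,
      AddMonoidAlgebra.coeff_single, Finsupp.single_apply]
    congr 1
    exact propext ⟨fun h => Subtype.ext h, fun h => congrArg Subtype.val h⟩

theorem coeff_monoidAlgebraToPolynomial_of_notMem (r : AddMonoidAlgebra K S) (i : ℕ)
    (hi : i ∉ S) : (monoidAlgebraToPolynomial K S r).coeff i = 0 := by
  induction r using AddMonoidAlgebra.induction_linear with
  | zero => simp
  | add f g hf hg => simp [hf, hg]
  | single s k =>
    rw [monoidAlgebraToPolynomial_single, Polynomial.coeff_monomial, if_neg]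
    rintro rfl
    exact hi s.2

theorem monoidAlgebraToPolynomial_injective :
    Function.Injective (monoidAlgebraToPolynomial K S) := by
  intro r s h
  ext ⟨i, hi⟩
  rw [← coeff_monoidAlgebraToPolynomial, h, coeff_monoidAlgebraToPolynomial]

theorem exists_monoidAlgebraToPolynomial_eq {p : K[X]} (hp : ∀ i ∉ S, p.coeff i = 0) :
    ∃ r, monoidAlgebraToPolynomial K S r = p := by
  classical
  refine ⟨∑ i ∈ p.support.attach, if h : (i : ℕ) ∈ S then
    AddMonoidAlgebra.single ⟨i, h⟩ (p.coeff i) else 0, ?_⟩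
  rw [map_sum, ← Finset.sum_coe_sort_eq_attach]
  conv_rhs => rw [p.as_sum_support, ← Finset.sum_coe_sort]
  refine Finset.sum_congr rfl fun i _ => ?_
  split_ifs with h
  · rw [monoidAlgebraToPolynomial_single]
  · simp [hp i h]

theorem notMem_iff_of_compl_eq_Icc (hS : (S : Set ℕ)ᶜ = Set.Icc 1 m) {i : ℕ} :
    i ∉ S ↔ 1 ≤ i ∧ i ≤ m := by
  have := Set.ext_iff.1 hS i
  simpa using this

/-- The image of `K[S]` in `K[X]` contains the conductor `X^{m+1}K[X]`. -/
theorem exists_monoidAlgebraToPolynomial_eq_X_pow_mul (hS : (S : Set ℕ)ᶜ = Set.Icc 1 m)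
    (p : K[X]) : ∃ r, monoidAlgebraToPolynomial K S r = Polynomial.X ^ (m + 1) * p := by
  refine exists_monoidAlgebraToPolynomial_eq fun i hi => ?_
  rw [Polynomial.coeff_X_pow_mul', if_neg]
  have := (notMem_iff_of_compl_eq_Icc hS).1 hi
  omega

/-- An element of `K[S]` is congruent to its constant term modulo the conductor. -/
theorem exists_monoidAlgebraToPolynomial_eq_C_add (hS : (S : Set ℕ)ᶜ = Set.Icc 1 m)
    (r : AddMonoidAlgebra K S) : ∃ p : K[X], monoidAlgebraToPolynomial K S r =
      Polynomial.C ((monoidAlgebraToPolynomial K S r).coeff 0) + Polynomial.X ^ (m + 1) * p := by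
  set q := monoidAlgebraToPolynomial K S r with hq
  have : Polynomial.X ^ (m + 1) ∣ q - Polynomial.C (q.coeff 0) := by
    rw [Polynomial.X_pow_dvd_iff]
    intro d hd
    rcases Nat.eq_zero_or_pos d with rfl | h0
    · simp
    · rw [Polynomial.coeff_sub, Polynomial.coeff_C_of_ne_zero h0.ne', hq,
        coeff_monoidAlgebraToPolynomial_of_notMem _ _
          ((notMem_iff_of_compl_eq_Icc hS).2 ⟨h0, by omega⟩), sub_zero]
  obtain ⟨p, hp⟩ := this
  exact ⟨p, by rw [← hp]; ring⟩

/-- Membership in `K[S]` of a polynomial congruent to a constant modulo the conductor. -/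
theorem exists_monoidAlgebraToPolynomial_eq_of_X_pow_dvd (hS : (S : Set ℕ)ᶜ = Set.Icc 1 m)
    {p : K[X]} {c : K} (h : Polynomial.X ^ (m + 1) ∣ p - Polynomial.C c) :
    ∃ r, monoidAlgebraToPolynomial K S r = p := by
  obtain ⟨q, hq⟩ := h
  obtain ⟨r, hr⟩ := exists_monoidAlgebraToPolynomial_eq_X_pow_mul hS q
  refine ⟨algebraMap K _ c + r, ?_⟩
  rw [map_add, AlgHom.commutes, hr, ← hq, Polynomial.algebraMap_eq]
  ring

/-- If `a ∈ K[S]` has a nonzero constant term, then `ah ∈ K[S]` forces `h ∈ K[S]`. -/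
theorem exists_monoidAlgebraToPolynomial_eq_of_mul (hS : (S : Set ℕ)ᶜ = Set.Icc 1 m)
    {a b : AddMonoidAlgebra K S} {h : K[X]}
    (ha : (monoidAlgebraToPolynomial K S a).coeff 0 ≠ 0)
    (hb : monoidAlgebraToPolynomial K S b = monoidAlgebraToPolynomial K S a * h) :
    ∃ r, monoidAlgebraToPolynomial K S r = h := by
  obtain ⟨p, hp⟩ := exists_monoidAlgebraToPolynomial_eq_C_add hS a
  obtain ⟨q, hq⟩ := exists_monoidAlgebraToPolynomial_eq_C_add hS b
  set a₀ := (monoidAlgebraToPolynomial K S a).coeff 0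
  set b₀ := (monoidAlgebraToPolynomial K S b).coeff 0
  refine exists_monoidAlgebraToPolynomial_eq_of_X_pow_dvd hS (c := a₀⁻¹ * b₀)
    ⟨Polynomial.C a₀⁻¹ * (q - p * h), ?_⟩
  have h1 : Polynomial.C a₀⁻¹ * Polynomial.C a₀ = 1 := by
    rw [← Polynomial.C_mul, inv_mul_cancel₀ ha, Polynomial.C_1]
  rw [hp, hq] at hb
  rw [Polynomial.C_mul]
  linear_combination (-h) * h1 - Polynomial.C a₀⁻¹ * hb

/-- A polynomial with constant term `1` is invertible modulo `X^{m+1}`. -/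
theorem exists_mul_eq_one_add_X_pow_mul (m : ℕ) {f : K[X]} (hf : f.coeff 0 = 1) :
    ∃ g s : K[X], g.coeff 0 = 1 ∧ f * g = 1 + Polynomial.X ^ (m + 1) * s := by
  have h : IsCoprime f (Polynomial.X ^ (m + 1)) := by
    refine IsCoprime.pow_right ((Polynomial.irreducible_X.coprime_iff_not_dvd).2 ?_).symm
    rw [Polynomial.X_dvd_iff, hf]
    exact one_ne_zero
  obtain ⟨a, b, hab⟩ := h
  refine ⟨a, -b, ?_, by linear_combination hab⟩
  have := congrArg (fun p => Polynomial.coeff p 0) hab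
  simpa [Polynomial.mul_coeff_zero, hf] using this

theorem dvd_of_dvd_X_pow_mul {f p : K[X]} (hf : f.coeff 0 ≠ 0) {n : ℕ}
    (h : f ∣ Polynomial.X ^ n * p) : f ∣ p := by
  have : IsCoprime f (Polynomial.X ^ n) :=
    IsCoprime.pow_right ((Polynomial.irreducible_X.coprime_iff_not_dvd).2
      (by rwa [Polynomial.X_dvd_iff])).symm
  exact this.dvd_of_dvd_mul_left h

end Embedding

/-! ### The contracted ideals `fK[X] ∩ K[S]` -/

section Contracted

variable {K : Type*} [Field K] {S : AddSubmonoid ℕ} {m : ℕ}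

theorem mem_contractedIdeal {f : K[X]} {r : AddMonoidAlgebra K S} :
    r ∈ contractedIdeal S f ↔ f ∣ monoidAlgebraToPolynomial K S r := by
  rw [contractedIdeal, Ideal.mem_comap, Ideal.mem_span_singleton]

/-- An ideal inside `fK[X] ∩ K[S]` is all of it as soon as it contains `fX^{m+1}K[X]` and an
element with nonzero constant term. -/
theorem eq_contractedIdeal_of_le (hS : (S : Set ℕ)ᶜ = Set.Icc 1 m) {f : K[X]}
    (hf : f.coeff 0 ≠ 0) {J : Ideal (AddMonoidAlgebra K S)} (hJ : J ≤ contractedIdeal S f)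
    (hX : ∀ p : K[X], ∃ r ∈ J, monoidAlgebraToPolynomial K S r = Polynomial.X ^ (m + 1) * (f * p))
    {a : AddMonoidAlgebra K S} (haJ : a ∈ J)
    (ha : (monoidAlgebraToPolynomial K S a).coeff 0 ≠ 0) : J = contractedIdeal S f := by
  refine le_antisymm hJ fun r hr => ?_
  set c := (monoidAlgebraToPolynomial K S r).coeff 0 *
    ((monoidAlgebraToPolynomial K S a).coeff 0)⁻¹ with hc
  -- subtracting a multiple of `a` from `r` kills the constant term
  set t := r - algebraMap K _ c * a with ht
  have htf : t ∈ contractedIdeal S f := sub_mem hr (Ideal.mul_mem_left _ _ (hJ haJ))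
  have ht0 : (monoidAlgebraToPolynomial K S t).coeff 0 = 0 := by
    rw [ht, map_sub, map_mul, AlgHom.commutes, Polynomial.algebraMap_eq, Polynomial.coeff_sub,
      Polynomial.coeff_C_mul, hc, inv_mul_cancel_right₀ ha, sub_self]
  obtain ⟨p, hp⟩ := exists_monoidAlgebraToPolynomial_eq_C_add hS t
  rw [ht0, Polynomial.C_0, zero_add] at hp
  have hfp : f ∣ p := dvd_of_dvd_X_pow_mul hf (hp ▸ mem_contractedIdeal.1 htf)
  obtain ⟨q, rfl⟩ := hfp
  obtain ⟨s, hsJ, hs⟩ := hX q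
  have hts : t = s := monoidAlgebraToPolynomial_injective (hp.trans hs.symm)
  have : r = t + algebraMap K _ c * a := by rw [ht]; ring
  rw [this, hts]
  exact add_mem hsJ (Ideal.mul_mem_left _ _ haJ)

theorem exists_mem_contractedIdeal (hS : (S : Set ℕ)ᶜ = Set.Icc 1 m) {f : K[X]}
    (hf : f.coeff 0 = 1) : ∃ r ∈ contractedIdeal S f,
      (monoidAlgebraToPolynomial K S r).coeff 0 = 1 := by
  obtain ⟨g, s, hg, hfg⟩ := exists_mul_eq_one_add_X_pow_mul m hf
  obtain ⟨r, hr⟩ := exists_monoidAlgebraToPolynomial_eq_of_X_pow_dvd (p := f * g) (c := 1) hS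
    ⟨s, by rw [hfg]; simp⟩
  exact ⟨r, mem_contractedIdeal.2 ⟨g, hr⟩, by rw [hr, Polynomial.mul_coeff_zero, hf, hg, one_mul]⟩

theorem contractedIdeal_mul (hS : (S : Set ℕ)ᶜ = Set.Icc 1 m) {f g : K[X]}
    (hf : f.coeff 0 = 1) (hg : g.coeff 0 = 1) :
    contractedIdeal S f * contractedIdeal S g = contractedIdeal S (f * g) := by
  obtain ⟨a, ha, ha0⟩ := exists_mem_contractedIdeal hS hf
  obtain ⟨b, hb, hb0⟩ := exists_mem_contractedIdeal hS hg
  refine eq_contractedIdeal_of_le hS (a := a * b) (by simp [Polynomial.mul_coeff_zero, hf, hg])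
    ?_ ?_ (Ideal.mul_mem_mul ha hb) (by simp [Polynomial.mul_coeff_zero, ha0, hb0])
  · refine Ideal.mul_le.2 fun r hr s hs => mem_contractedIdeal.2 ?_
    rw [map_mul]
    exact mul_dvd_mul (mem_contractedIdeal.1 hr) (mem_contractedIdeal.1 hs)
  · intro p
    -- `1 = a - X^{m+1}t` for some `t`, so `X^{m+1}fgp = a(X^{m+1}gfp) - (X^{m+1}ft)(X^{m+1}gp)`
    obtain ⟨t, ht⟩ := exists_monoidAlgebraToPolynomial_eq_C_add hS a
    rw [ha0, Polynomial.C_1] at ht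
    obtain ⟨r₁, h₁⟩ := exists_monoidAlgebraToPolynomial_eq_X_pow_mul hS (g * (f * p))
    obtain ⟨r₂, h₂⟩ := exists_monoidAlgebraToPolynomial_eq_X_pow_mul hS (f * t)
    obtain ⟨r₃, h₃⟩ := exists_monoidAlgebraToPolynomial_eq_X_pow_mul hS (g * p)
    refine ⟨a * r₁ - r₂ * r₃, sub_mem (Ideal.mul_mem_mul ha ?_) (Ideal.mul_mem_mul ?_ ?_), ?_⟩
    · exact mem_contractedIdeal.2 (h₁ ▸ dvd_mul_of_dvd_right (dvd_mul_right _ _) _)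
    · exact mem_contractedIdeal.2 (h₂ ▸ dvd_mul_of_dvd_right (dvd_mul_right _ _) _)
    · exact mem_contractedIdeal.2 (h₃ ▸ dvd_mul_of_dvd_right (dvd_mul_right _ _) _)
    · rw [map_sub, map_mul, map_mul, h₁, h₂, h₃, ht]
      ring

/-- `fK[X] ∩ K[S]` is principal if `f ∈ K[S]` has a nonzero constant term. -/
theorem contractedIdeal_monoidAlgebraToPolynomial (hS : (S : Set ℕ)ᶜ = Set.Icc 1 m)
    {r : AddMonoidAlgebra K S} (hr : (monoidAlgebraToPolynomial K S r).coeff 0 ≠ 0) :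
    contractedIdeal S (monoidAlgebraToPolynomial K S r) = Ideal.span {r} := by
  ext s
  rw [mem_contractedIdeal, Ideal.mem_span_singleton]
  refine ⟨fun ⟨h, hh⟩ => ?_, fun h => map_dvd _ h⟩
  obtain ⟨t, rfl⟩ := exists_monoidAlgebraToPolynomial_eq_of_mul hS hr hh
  exact ⟨t, monoidAlgebraToPolynomial_injective (by rw [hh, map_mul])⟩

/-- The contracted ideals `fK[X] ∩ K[S]` with `f(0) = 1` are exactly the ideals of `K[S]` not
contained in the conductor `X^{m+1}K[X]`. -/
theorem exists_eq_contractedIdeal (hS : (S : Set ℕ)ᶜ = Set.Icc 1 m)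
    {J : Ideal (AddMonoidAlgebra K S)} {a : AddMonoidAlgebra K S} (haJ : a ∈ J)
    (ha : (monoidAlgebraToPolynomial K S a).coeff 0 ≠ 0) :
    ∃ f : K[X], f.coeff 0 = 1 ∧ J = contractedIdeal S f := by
  set ι := monoidAlgebraToPolynomial K S
  obtain ⟨g, hg⟩ := IsPrincipalIdealRing.principal (Ideal.map ι J)
  rw [← Ideal.span] at hg
  have hmem : ∀ r ∈ J, g ∣ ι r := fun r hr => by
    rw [← Ideal.mem_span_singleton, ← hg]
    exact Ideal.mem_map_of_mem _ hr
  have hg0 : g.coeff 0 ≠ 0 := by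
    obtain ⟨q, hq⟩ := hmem a haJ
    rw [hq, Polynomial.mul_coeff_zero] at ha
    exact left_ne_zero_of_mul ha
  have hmul : ∀ y ∈ Ideal.map ι J, ∀ p : K[X], ∃ r ∈ J, ι r = Polynomial.X ^ (m + 1) * (y * p) := by
    intro y hy
    induction hy using Submodule.span_induction with
    | mem y hy =>
      obtain ⟨j, hj, rfl⟩ := hy
      intro p
      obtain ⟨r, hr⟩ := exists_monoidAlgebraToPolynomial_eq_X_pow_mul hS p
      exact ⟨j * r, Ideal.mul_mem_right _ _ hj, by
        rw [map_mul]
        change ι j * monoidAlgebraToPolynomial K S r = _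
        rw [hr]
        ring⟩
    | zero => exact fun p => ⟨0, zero_mem _, by simp⟩
    | add y z _ _ hy hz =>
      intro p
      obtain ⟨r, hr, hr'⟩ := hy p
      obtain ⟨s, hs, hs'⟩ := hz p
      exact ⟨r + s, add_mem hr hs, by rw [map_add, hr', hs']; ring⟩
    | smul c y _ hy =>
      intro p
      obtain ⟨r, hr, hr'⟩ := hy (c * p)
      exact ⟨r, hr, by rw [hr', smul_eq_mul]; ring⟩
  have hu : Polynomial.C (g.coeff 0)⁻¹ * Polynomial.C (g.coeff 0) = 1 := by
    rw [← Polynomial.C_mul, inv_mul_cancel₀ hg0, Polynomial.C_1]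
  refine ⟨Polynomial.C (g.coeff 0)⁻¹ * g, by simp [hg0], ?_⟩
  refine eq_contractedIdeal_of_le hS (by simp [hg0]) (fun r hr => mem_contractedIdeal.2 ?_) ?_
    haJ ha
  · obtain ⟨q, hq⟩ := hmem r hr
    exact ⟨Polynomial.C (g.coeff 0) * q, by
      change ι r = _
      rw [hq]; linear_combination (-g * q) * hu⟩
  · intro p
    obtain ⟨r, hr, hr'⟩ := hmul g (hg ▸ Ideal.mem_span_singleton_self g)
      (Polynomial.C (g.coeff 0)⁻¹ * p)
    exact ⟨r, hr, by change ι r = _; rw [hr']; ring⟩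

theorem contractedIdeal_le_iff (hS : (S : Set ℕ)ᶜ = Set.Icc 1 m) {f g : K[X]}
    (hg : g.coeff 0 = 1) : contractedIdeal S f ≤ contractedIdeal S g ↔ g ∣ f := by
  constructor
  · intro h
    obtain ⟨r, hr⟩ := exists_monoidAlgebraToPolynomial_eq_X_pow_mul hS f
    have : r ∈ contractedIdeal S f := mem_contractedIdeal.2 (hr ▸ dvd_mul_left _ _)
    have := mem_contractedIdeal.1 (h this)
    rw [hr] at this
    exact dvd_of_dvd_X_pow_mul (by simp [hg]) this
  · exact fun h r hr => mem_contractedIdeal.2 (h.trans (mem_contractedIdeal.1 hr))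

theorem eq_of_associated_of_coeff_zero {f g : K[X]} (hf : f.coeff 0 = 1) (hg : g.coeff 0 = 1)
    (h : Associated f g) : f = g := by
  obtain ⟨u, rfl⟩ := h
  obtain ⟨c, -, hc⟩ := Polynomial.isUnit_iff.1 u.isUnit
  rw [← hc, Polynomial.mul_coeff_zero, hf, Polynomial.coeff_C_zero, one_mul] at hg
  rw [← hc, hg, Polynomial.C_1, mul_one]

theorem contractedIdeal_injOn (hS : (S : Set ℕ)ᶜ = Set.Icc 1 m) :
    Set.InjOn (contractedIdeal S) {f : K[X] | f.coeff 0 = 1} := by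
  intro f hf g hg h
  exact eq_of_associated_of_coeff_zero hf hg (associated_of_dvd_dvd
    ((contractedIdeal_le_iff hS hf).1 h.ge) ((contractedIdeal_le_iff hS hg).1 h.le))

/-- If `fK[X] ∩ K[S]` is principal and `f(0) = 1`, then `f ∈ K[S]`. -/
theorem exists_eq_of_contractedIdeal_eq_span (hS : (S : Set ℕ)ᶜ = Set.Icc 1 m) {f : K[X]}
    (hf : f.coeff 0 = 1) {r : AddMonoidAlgebra K S} (h : contractedIdeal S f = Ideal.span {r}) :
    ∃ s, monoidAlgebraToPolynomial K S s = f := by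
  obtain ⟨a, ha, ha0⟩ := exists_mem_contractedIdeal hS hf
  have hr0 : (monoidAlgebraToPolynomial K S r).coeff 0 ≠ 0 := by
    rw [h, Ideal.mem_span_singleton] at ha
    obtain ⟨q, rfl⟩ := ha
    rw [map_mul, Polynomial.mul_coeff_zero] at ha0
    exact left_ne_zero_of_mul (ha0 ▸ one_ne_zero)
  set c := (monoidAlgebraToPolynomial K S r).coeff 0
  have hs : monoidAlgebraToPolynomial K S (algebraMap K _ c⁻¹ * r) =
      Polynomial.C c⁻¹ * monoidAlgebraToPolynomial K S r := by
    rw [map_mul, AlgHom.commutes, Polynomial.algebraMap_eq]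
  have hs0 : (monoidAlgebraToPolynomial K S (algebraMap K _ c⁻¹ * r)).coeff 0 = 1 := by
    rw [hs, Polynomial.coeff_C_mul]
    exact inv_mul_cancel₀ hr0
  refine ⟨algebraMap K _ c⁻¹ * r, contractedIdeal_injOn hS hs0 hf ?_⟩
  rw [contractedIdeal_monoidAlgebraToPolynomial hS (hs0 ▸ one_ne_zero), h]
  refine Ideal.span_singleton_mul_left_unit ?_ _
  exact (IsUnit.mk0 _ (inv_ne_zero hr0)).map _

end Contracted

/-! ### Invertible ideals and the `v`-class group -/

section VClassGroup

variable {R : Type*} [CommRing R] [IsDomain R]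

theorem VInvertibleVIdeal.ext_toFractionalIdeal {V W : VInvertibleVIdeal R}
    (h : (V : FractionalVIdeal R).toFractionalIdeal = (W : FractionalVIdeal R).toFractionalIdeal) :
    V = W :=
  Units.ext (FractionalVIdeal.ext h)

theorem invertibleToV_injective : Function.Injective (invertibleToV R) := by
  intro I J h
  refine Units.ext ?_
  rw [← toFractionalIdeal_invertibleToV I, h, toFractionalIdeal_invertibleToV]

theorem VClassGroup.mk_eq_one_iff {V : VInvertibleVIdeal R} :
    VClassGroup.mk V = 1 ↔ V ∈ principalV R :=
  QuotientGroup.eq_one_iff V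

theorem VClassGroup.mk_invertibleToV_eq_one_iff {I : (FractionalIdeal R⁰ (FractionRing R))ˣ} :
    VClassGroup.mk (invertibleToV R I) = 1 ↔
      I ∈ (toPrincipalIdeal R (FractionRing R)).range := by
  rw [mk_eq_one_iff, principalV]
  exact Subgroup.mem_map_iff_mem invertibleToV_injective

theorem picToVClassGroup_mk (I : (FractionalIdeal R⁰ (FractionRing R))ˣ) :
    picToVClassGroup R (QuotientGroup.mk I) = VClassGroup.mk (invertibleToV R I) := rfl

theorem picToVClassGroup_injective : Function.Injective (picToVClassGroup R) := by
  rw [injective_iff_map_eq_one]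
  intro c hc
  induction c using QuotientGroup.induction_on with
  | H I =>
    rw [picToVClassGroup_mk, VClassGroup.mk_invertibleToV_eq_one_iff] at hc
    exact (QuotientGroup.eq_one_iff I).2 hc

theorem VInvertibleVIdeal.inv_inv_mul_eq_one (V : VInvertibleVIdeal R) :
    ((V : FractionalVIdeal R).toFractionalIdeal *
      ((V⁻¹ : VInvertibleVIdeal R) : FractionalVIdeal R).toFractionalIdeal)⁻¹⁻¹ = 1 := by
  have h := congrArg FractionalVIdeal.toFractionalIdeal V.mul_inv
  rwa [FractionalVIdeal.toFractionalIdeal_one] at h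

theorem VInvertibleVIdeal.mul_inv_le_one (V : VInvertibleVIdeal R) :
    (V : FractionalVIdeal R).toFractionalIdeal *
      ((V⁻¹ : VInvertibleVIdeal R) : FractionalVIdeal R).toFractionalIdeal ≤ 1 :=
  (VIdeal.le_inv_inv _).trans V.inv_inv_mul_eq_one.le

theorem VInvertibleVIdeal.inv_mul_eq_one (V : VInvertibleVIdeal R) :
    ((V : FractionalVIdeal R).toFractionalIdeal *
      ((V⁻¹ : VInvertibleVIdeal R) : FractionalVIdeal R).toFractionalIdeal)⁻¹ = 1 := by
  rw [← VIdeal.inv_inv_inv, V.inv_inv_mul_eq_one, inv_one]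

theorem VInvertibleVIdeal.toFractionalIdeal_mul_ne_zero (V : VInvertibleVIdeal R) :
    (V : FractionalVIdeal R).toFractionalIdeal *
      ((V⁻¹ : VInvertibleVIdeal R) : FractionalVIdeal R).toFractionalIdeal ≠ 0 := by
  intro h
  have := V.inv_inv_mul_eq_one
  rw [h, FractionalIdeal.inv_zero', FractionalIdeal.inv_zero'] at this
  exact zero_ne_one this

end VClassGroup

/-! ### The element `X` of the quotient field and the regular elements -/

section Regular

variable {K : Type*} [Field K] {S : AddSubmonoid ℕ} {m : ℕ}

/-- The element `X` of the quotient field of `K[S]`: it is almost integral over `K[S]`, it does not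
belong to `K[S]`, and it multiplies the elements with constant term `0` into `K[S]`. -/
theorem exists_fractionRing_X (hm : 1 ≤ m) (hS : (S : Set ℕ)ᶜ = Set.Icc 1 m) :
    ∃ t : FractionRing (AddMonoidAlgebra K S),
      t ∉ (algebraMap (AddMonoidAlgebra K S) (FractionRing (AddMonoidAlgebra K S))).range ∧
      t ∈ completeIntegralClosure (AddMonoidAlgebra K S) (FractionRing (AddMonoidAlgebra K S)) ∧
      ∀ r : AddMonoidAlgebra K S, (monoidAlgebraToPolynomial K S r).coeff 0 = 0 →
        ∃ r' : AddMonoidAlgebra K S,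
          monoidAlgebraToPolynomial K S r' = Polynomial.X * monoidAlgebraToPolynomial K S r ∧
          t * algebraMap _ _ r = algebraMap _ _ r' := by
  obtain ⟨x₁, h₁⟩ := exists_monoidAlgebraToPolynomial_eq_X_pow_mul (K := K) hS 1
  obtain ⟨x₂, h₂⟩ := exists_monoidAlgebraToPolynomial_eq_X_pow_mul (K := K) hS Polynomial.X
  rw [mul_one] at h₁
  have hX : (Polynomial.X : K[X]) ^ (m + 1) ≠ 0 := pow_ne_zero _ Polynomial.X_ne_zero
  have hx₁ : x₁ ≠ 0 := by
    rintro rfl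
    exact hX (by rw [← h₁, map_zero])
  have hx₁' : algebraMap (AddMonoidAlgebra K S) (FractionRing (AddMonoidAlgebra K S)) x₁ ≠ 0 := by
    simpa using hx₁
  set t : FractionRing (AddMonoidAlgebra K S) := algebraMap _ _ x₂ / algebraMap _ _ x₁ with ht
  have key : ∀ r r' : AddMonoidAlgebra K S,
      monoidAlgebraToPolynomial K S r' = Polynomial.X * monoidAlgebraToPolynomial K S r →
      t * algebraMap _ _ r = algebraMap _ _ r' := by
    intro r r' h
    rw [ht, div_mul_eq_mul_div, div_eq_iff hx₁', ← map_mul, ← map_mul]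
    congr 1
    apply monoidAlgebraToPolynomial_injective
    rw [map_mul, map_mul, h, h₁, h₂]
    ring
  refine ⟨t, ?_, ⟨x₁, mem_nonZeroDivisors_of_ne_zero hx₁, fun n => ?_⟩, fun r hr => ?_⟩
  · rintro ⟨r, hr⟩
    rw [ht, eq_div_iff hx₁', ← map_mul] at hr
    have h := congrArg (monoidAlgebraToPolynomial K S)
      (IsFractionRing.injective (AddMonoidAlgebra K S) (FractionRing (AddMonoidAlgebra K S)) hr)
    rw [map_mul, h₁, h₂, mul_comm] at h
    have h1 := mul_left_cancel₀ hX h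
    have h2 := coeff_monoidAlgebraToPolynomial_of_notMem r 1
      ((notMem_iff_of_compl_eq_Icc hS).2 ⟨le_rfl, hm⟩)
    rw [h1, Polynomial.coeff_X_one] at h2
    exact one_ne_zero h2
  · suffices h : ∃ r : AddMonoidAlgebra K S,
        monoidAlgebraToPolynomial K S r = Polynomial.X ^ (m + 1) * Polynomial.X ^ n ∧
        algebraMap _ _ r = x₁ • t ^ n by
      obtain ⟨r, -, hr⟩ := h
      exact ⟨r, hr⟩
    induction n with
    | zero => exact ⟨x₁, by rw [h₁, pow_zero, mul_one], by simp [Algebra.smul_def]⟩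
    | succ n ih =>
      obtain ⟨r, hr, hr'⟩ := ih
      obtain ⟨r', h'⟩ := exists_monoidAlgebraToPolynomial_eq_X_pow_mul (K := K) hS
        (Polynomial.X ^ (n + 1))
      refine ⟨r', h', ?_⟩
      rw [← key r r' (by rw [hr, h']; ring), hr', pow_succ, Algebra.smul_def, Algebra.smul_def]
      ring
  · obtain ⟨p, hp⟩ := exists_monoidAlgebraToPolynomial_eq_C_add hS r
    rw [hr, Polynomial.C_0, zero_add] at hp
    obtain ⟨r', h'⟩ := exists_monoidAlgebraToPolynomial_eq_X_pow_mul hS (Polynomial.X * p)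
    have : monoidAlgebraToPolynomial K S r' =
        Polynomial.X * monoidAlgebraToPolynomial K S r := by rw [h', hp]; ring
    exact ⟨r', this, key r r' this⟩

/-- `K[X]` is completely integrally closed. -/
theorem Polynomial.dvd_of_forall_pow_dvd_mul_pow {a b d : K[X]} (hd : d ≠ 0) (ha : a ≠ 0)
    (h : ∀ n, a ^ n ∣ d * b ^ n) : a ∣ b := by
  have ha' : algebraMap K[X] (FractionRing K[X]) a ≠ 0 := by simpa using ha
  have hint : IsAlmostIntegral K[X]
      (algebraMap K[X] (FractionRing K[X]) b / algebraMap K[X] (FractionRing K[X]) a) := by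
    refine ⟨d, mem_nonZeroDivisors_of_ne_zero hd, fun n => ?_⟩
    obtain ⟨c, hc⟩ := h n
    refine ⟨c, ?_⟩
    rw [Algebra.smul_def, div_pow, mul_div_assoc', eq_div_iff (pow_ne_zero _ ha'), ← map_pow,
      ← map_pow, ← map_mul, ← map_mul, hc, mul_comm]
  obtain ⟨c, hc⟩ := IsIntegrallyClosed.isIntegral_iff.1 hint.isIntegral
  rw [eq_div_iff ha', ← map_mul] at hc
  exact ⟨c, by rw [mul_comm, IsFractionRing.injective K[X] (FractionRing K[X]) hc]⟩

/-- The regular elements of `K[S]` are those with a nonzero constant term. -/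
theorem mem_regularElements_iff (hm : 1 ≤ m) (hS : (S : Set ℕ)ᶜ = Set.Icc 1 m)
    {a : AddMonoidAlgebra K S} :
    a ∈ regularElements (AddMonoidAlgebra K S) ↔
      (monoidAlgebraToPolynomial K S a).coeff 0 ≠ 0 := by
  constructor
  · intro ha h0
    obtain ⟨t, ht, htc, hmul⟩ := exists_fractionRing_X (K := K) hm hS
    obtain ⟨r, -, hr⟩ := hmul a h0
    exact ht (ha t htc ⟨r, hr.symm⟩)
  · rintro ha z ⟨d, hd, hz⟩ ⟨b, hb⟩
    have ha0 : a ≠ 0 := by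
      rintro rfl
      simp at ha
    have hinj := IsFractionRing.injective (AddMonoidAlgebra K S)
      (FractionRing (AddMonoidAlgebra K S))
    have hdvd : monoidAlgebraToPolynomial K S a ∣ monoidAlgebraToPolynomial K S b := by
      refine Polynomial.dvd_of_forall_pow_dvd_mul_pow (d := monoidAlgebraToPolynomial K S d)
        ?_ ?_ fun n => ?_
      · rw [Ne, map_eq_zero_iff _ monoidAlgebraToPolynomial_injective]
        exact nonZeroDivisors.ne_zero hd
      · rwa [Ne, map_eq_zero_iff _ monoidAlgebraToPolynomial_injective]
      · obtain ⟨c, hc⟩ := hz n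
        rw [← map_pow, ← map_pow, ← map_mul]
        refine map_dvd _ ⟨c, hinj ?_⟩
        rw [map_mul, map_mul, map_pow, map_pow, hb, hc, Algebra.smul_def]
        ring
    obtain ⟨h, hh⟩ := hdvd
    obtain ⟨r, rfl⟩ := exists_monoidAlgebraToPolynomial_eq_of_mul hS ha hh
    rw [← map_mul] at hh
    refine ⟨r, ?_⟩
    have ha0' : algebraMap (AddMonoidAlgebra K S) (FractionRing (AddMonoidAlgebra K S)) a ≠ 0 := by
      simpa using ha0
    refine mul_right_cancel₀ ha0' ?_
    rw [← hb, monoidAlgebraToPolynomial_injective hh, map_mul, mul_comm]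

theorem nonempty_contractedIdeal_inter_regularElements (hm : 1 ≤ m)
    (hS : (S : Set ℕ)ᶜ = Set.Icc 1 m) {f : K[X]} (hf : f.coeff 0 = 1) :
    ((contractedIdeal S f : Set (AddMonoidAlgebra K S)) ∩
      regularElements (AddMonoidAlgebra K S)).Nonempty := by
  obtain ⟨a, ha, ha0⟩ := exists_mem_contractedIdeal hS hf
  exact ⟨a, ha, (mem_regularElements_iff hm hS).2 (ha0 ▸ one_ne_zero)⟩

/-- An ideal that contains a regular element is determined by its regular elements. -/
theorem eq_of_inter_regularElements_eq (hm : 1 ≤ m) (hS : (S : Set ℕ)ᶜ = Set.Icc 1 m)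
    {I J : Ideal (AddMonoidAlgebra K S)}
    (hJ : ((J : Set (AddMonoidAlgebra K S)) ∩ regularElements (AddMonoidAlgebra K S)).Nonempty)
    (h : (I : Set (AddMonoidAlgebra K S)) ∩ regularElements (AddMonoidAlgebra K S) =
      (J : Set (AddMonoidAlgebra K S)) ∩ regularElements (AddMonoidAlgebra K S)) : I = J := by
  have key : ∀ {I J : Ideal (AddMonoidAlgebra K S)},
      ((J : Set (AddMonoidAlgebra K S)) ∩ regularElements (AddMonoidAlgebra K S)).Nonempty →
      (I : Set (AddMonoidAlgebra K S)) ∩ regularElements (AddMonoidAlgebra K S) =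
        (J : Set (AddMonoidAlgebra K S)) ∩ regularElements (AddMonoidAlgebra K S) → I ≤ J := by
    intro I J hJ h r hr
    obtain ⟨a, haJ, ha⟩ := hJ
    have haI : a ∈ I := ((Set.ext_iff.1 h a).2 ⟨haJ, ha⟩).1
    by_cases hr0 : (monoidAlgebraToPolynomial K S r).coeff 0 = 0
    · -- `r = (r + a) - a` with both terms regular
      have h1 : r + a ∈ J := ((Set.ext_iff.1 h (r + a)).1 ⟨add_mem hr haI, by
        rw [mem_regularElements_iff hm hS] at ha ⊢
        simpa [hr0] using ha⟩).1
      simpa using sub_mem h1 haJ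
    · exact ((Set.ext_iff.1 h r).1 ⟨hr, (mem_regularElements_iff hm hS).2 hr0⟩).1
  exact le_antisymm (key hJ h) (key (h ▸ hJ) h.symm)

end Regular

/-! ### The classes of the contracted ideals -/

section Classes

variable {K : Type*} [Field K] {S : AddSubmonoid ℕ} {m : ℕ}

/-- Two polynomials agree up to degree `m` iff they are congruent modulo `X^{m+1}`. -/
theorem truncatePoly_eq_iff {f g : K[X]} :
    truncatePoly m f = truncatePoly m g ↔ Polynomial.X ^ (m + 1) ∣ f - g := by
  rw [Polynomial.X_pow_dvd_iff]
  constructor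
  · intro h d hd
    have := congrArg (fun p => Polynomial.coeff p d) h
    simp only [coeff_truncatePoly, if_pos (Nat.lt_succ_iff.1 hd)] at this
    rw [Polynomial.coeff_sub, this, sub_self]
  · intro h
    ext j
    rw [coeff_truncatePoly, coeff_truncatePoly]
    split_ifs with hj
    · exact sub_eq_zero.1 (by rw [← Polynomial.coeff_sub]; exact h j (Nat.lt_succ_of_le hj))
    · rfl

theorem isUnit_coeIdeal_contractedIdeal (hS : (S : Set ℕ)ᶜ = Set.Icc 1 m) {f : K[X]}
    (hf : f.coeff 0 = 1) :
    IsUnit (contractedIdeal S f :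
      FractionalIdeal (AddMonoidAlgebra K S)⁰ (FractionRing (AddMonoidAlgebra K S))) := by
  obtain ⟨g, s, hg, hfg⟩ := exists_mul_eq_one_add_X_pow_mul m hf
  obtain ⟨r, hr⟩ := exists_monoidAlgebraToPolynomial_eq_of_X_pow_dvd (p := f * g) (c := 1) hS
    ⟨s, by rw [hfg]; simp⟩
  have hr0 : (monoidAlgebraToPolynomial K S r).coeff 0 ≠ 0 := by
    rw [hr, Polynomial.mul_coeff_zero, hf, hg, one_mul]
    exact one_ne_zero
  refine isUnit_of_mul_isUnit_left (y := (contractedIdeal S g : FractionalIdeal _ _)) ?_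
  rw [← FractionalIdeal.coeIdeal_mul, contractedIdeal_mul hS hf hg, ← hr,
    contractedIdeal_monoidAlgebraToPolynomial hS hr0, FractionalIdeal.coeIdeal_span_singleton]
  have hne : algebraMap (AddMonoidAlgebra K S) (FractionRing (AddMonoidAlgebra K S)) r ≠ 0 := by
    have : r ≠ 0 := by
      rintro rfl
      simp at hr0
    simpa using this
  exact ⟨toPrincipalIdeal _ _ (Units.mk0 _ hne), coe_toPrincipalIdeal _⟩

/-- The ideal `fK[X] ∩ K[S]`, where `f(0) = 1`, as an invertible fractional ideal. -/
noncomputable def contractedUnit (hS : (S : Set ℕ)ᶜ = Set.Icc 1 m) (f : K[X])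
    (hf : f.coeff 0 = 1) :
    (FractionalIdeal (AddMonoidAlgebra K S)⁰ (FractionRing (AddMonoidAlgebra K S)))ˣ :=
  (isUnit_coeIdeal_contractedIdeal hS hf).unit

theorem coe_contractedUnit (hS : (S : Set ℕ)ᶜ = Set.Icc 1 m) (f : K[X]) (hf : f.coeff 0 = 1) :
    (contractedUnit hS f hf :
      FractionalIdeal (AddMonoidAlgebra K S)⁰ (FractionRing (AddMonoidAlgebra K S))) =
      contractedIdeal S f :=
  rfl

theorem isIdeal_invertibleToV_contractedUnit (hS : (S : Set ℕ)ᶜ = Set.Icc 1 m) (f : K[X])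
    (hf : f.coeff 0 = 1) :
    (invertibleToV _ (contractedUnit hS f hf)).IsIdeal (contractedIdeal S f) := by
  rw [VInvertibleVIdeal.IsIdeal, toFractionalIdeal_invertibleToV, coe_contractedUnit]

theorem VInvertibleVIdeal.IsIdeal.eq_invertibleToV (hS : (S : Set ℕ)ᶜ = Set.Icc 1 m) {f : K[X]}
    (hf : f.coeff 0 = 1) {V : VInvertibleVIdeal (AddMonoidAlgebra K S)}
    (hV : V.IsIdeal (contractedIdeal S f)) : V = invertibleToV _ (contractedUnit hS f hf) :=
  VInvertibleVIdeal.ext_toFractionalIdeal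
    (hV.trans (isIdeal_invertibleToV_contractedUnit hS f hf).symm)

/-- The class of `fK[X] ∩ K[S]`, where `f(0) = 1`, in the `v`-class group. -/
noncomputable def contractedClass (hS : (S : Set ℕ)ᶜ = Set.Icc 1 m) (f : K[X])
    (hf : f.coeff 0 = 1) :
    VClassGroup (AddMonoidAlgebra K S) :=
  VClassGroup.mk (invertibleToV _ (contractedUnit hS f hf))

theorem coeff_zero_mul_eq_one {f g : K[X]} (hf : f.coeff 0 = 1) (hg : g.coeff 0 = 1) :
    (f * g).coeff 0 = 1 := by
  rw [Polynomial.mul_coeff_zero, hf, hg, one_mul]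

theorem contractedClass_mul (hS : (S : Set ℕ)ᶜ = Set.Icc 1 m) {f g : K[X]}
    (hf : f.coeff 0 = 1) (hg : g.coeff 0 = 1) :
    contractedClass hS f hf * contractedClass hS g hg =
      contractedClass hS (f * g) (coeff_zero_mul_eq_one hf hg) := by
  rw [contractedClass, contractedClass, contractedClass, ← map_mul, ← map_mul]
  congr 2
  refine Units.ext ?_
  rw [Units.val_mul, coe_contractedUnit, coe_contractedUnit, coe_contractedUnit,
    ← FractionalIdeal.coeIdeal_mul, contractedIdeal_mul hS hf hg]

theorem contractedClass_eq_one_iff (hS : (S : Set ℕ)ᶜ = Set.Icc 1 m) {f : K[X]}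
    (hf : f.coeff 0 = 1) :
    contractedClass hS f hf = 1 ↔ ∃ r, monoidAlgebraToPolynomial K S r = f := by
  rw [contractedClass, VClassGroup.mk_invertibleToV_eq_one_iff, mem_principal_ideals_iff,
    coe_contractedUnit]
  constructor
  · rintro ⟨x, hx⟩
    have hmem := FractionalIdeal.mem_spanSingleton_self (AddMonoidAlgebra K S)⁰ x
    rw [hx, FractionalIdeal.mem_coeIdeal] at hmem
    obtain ⟨r, -, rfl⟩ := hmem
    rw [← FractionalIdeal.coeIdeal_span_singleton] at hx
    exact exists_eq_of_contractedIdeal_eq_span hS hf (FractionalIdeal.coeIdeal_injective hx).symm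
  · rintro ⟨r, rfl⟩
    exact ⟨algebraMap _ _ r, by
      rw [← FractionalIdeal.coeIdeal_span_singleton,
        contractedIdeal_monoidAlgebraToPolynomial hS (hf ▸ one_ne_zero)]⟩

/-- Polynomials congruent modulo `X^{m+1}` have a common inverse `h` modulo `X^{m+1}`, and the
class of `hK[X] ∩ K[S]` is then inverse to both of their classes. -/
theorem contractedClass_congr (hS : (S : Set ℕ)ᶜ = Set.Icc 1 m) {f g : K[X]}
    (hf : f.coeff 0 = 1) (hg : g.coeff 0 = 1) (h : truncatePoly m f = truncatePoly m g) :
    contractedClass hS f hf = contractedClass hS g hg := by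
  obtain ⟨k, s, hk, hfk⟩ := exists_mul_eq_one_add_X_pow_mul m hf
  obtain ⟨q, hq⟩ := truncatePoly_eq_iff.1 h
  have h1 : contractedClass hS f hf * contractedClass hS k hk = 1 := by
    rw [contractedClass_mul, contractedClass_eq_one_iff]
    exact exists_monoidAlgebraToPolynomial_eq_of_X_pow_dvd (c := 1) hS ⟨s, by rw [hfk]; simp⟩
  have h2 : contractedClass hS g hg * contractedClass hS k hk = 1 := by
    rw [contractedClass_mul, contractedClass_eq_one_iff]
    refine exists_monoidAlgebraToPolynomial_eq_of_X_pow_dvd (c := 1) hS ⟨s - q * k, ?_⟩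
    rw [Polynomial.C_1]
    linear_combination hfk - k * hq
  exact mul_right_cancel (h1.trans h2.symm)

/-- A `v`-invertible `v`-ideal has an element `x`, and its `v`-inverse an element `y`, such that
`xy` belongs to `K[S]` and has a nonzero constant term: otherwise `X` would lie in the inverse of
the product of the two ideals, which is `K[S]`. -/
theorem exists_mul_coeff_zero_ne_zero (hm : 1 ≤ m) (hS : (S : Set ℕ)ᶜ = Set.Icc 1 m)
    (V : VInvertibleVIdeal (AddMonoidAlgebra K S)) :
    ∃ x ∈ (V : FractionalVIdeal (AddMonoidAlgebra K S)).toFractionalIdeal,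
      ∃ y ∈ ((V⁻¹ : VInvertibleVIdeal (AddMonoidAlgebra K S)) :
        FractionalVIdeal (AddMonoidAlgebra K S)).toFractionalIdeal,
      ∃ r : AddMonoidAlgebra K S, algebraMap _ _ r = x * y ∧
        (monoidAlgebraToPolynomial K S r).coeff 0 ≠ 0 := by
  by_contra! hcon
  obtain ⟨t, ht, -, hmul⟩ := exists_fractionRing_X (K := K) hm hS
  have hle : (V : FractionalVIdeal (AddMonoidAlgebra K S)).toFractionalIdeal *
      ((V⁻¹ : VInvertibleVIdeal (AddMonoidAlgebra K S)) :
        FractionalVIdeal (AddMonoidAlgebra K S)).toFractionalIdeal ≤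
      (contractedIdeal S (Polynomial.X : K[X]) :
        FractionalIdeal (AddMonoidAlgebra K S)⁰ (FractionRing (AddMonoidAlgebra K S))) := by
    refine FractionalIdeal.mul_le.2 fun x hx y hy => ?_
    obtain ⟨r, hr⟩ := (FractionalIdeal.mem_one_iff _).1
      (V.mul_inv_le_one (FractionalIdeal.mul_mem_mul hx hy))
    rw [← hr]
    refine FractionalIdeal.mem_coeIdeal_of_mem _ (mem_contractedIdeal.2 ?_)
    rw [Polynomial.X_dvd_iff]
    exact hcon x hx y hy r hr
  have hmem : t ∈ ((V : FractionalVIdeal (AddMonoidAlgebra K S)).toFractionalIdeal *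
      ((V⁻¹ : VInvertibleVIdeal (AddMonoidAlgebra K S)) :
        FractionalVIdeal (AddMonoidAlgebra K S)).toFractionalIdeal)⁻¹ := by
    refine (FractionalIdeal.mem_inv_iff V.toFractionalIdeal_mul_ne_zero).2 fun z hz => ?_
    obtain ⟨r, hr, rfl⟩ := (FractionalIdeal.mem_coeIdeal _).1 (hle hz)
    obtain ⟨r', -, hr'⟩ := hmul r (Polynomial.X_dvd_iff.1 (mem_contractedIdeal.1 hr))
    exact (FractionalIdeal.mem_one_iff _).2 ⟨r', hr'.symm⟩
  rw [V.inv_mul_eq_one] at hmem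
  exact ht ((FractionalIdeal.mem_one_iff _).1 hmem)

/-- Every `v`-invertible `v`-ideal of `K[S]` is a principal multiple of some `fK[X] ∩ K[S]` with
`f(0) = 1`; in particular it is invertible. -/
theorem exists_eq_invertibleToV (hm : 1 ≤ m) (hS : (S : Set ℕ)ᶜ = Set.Icc 1 m)
    (V : VInvertibleVIdeal (AddMonoidAlgebra K S)) :
    ∃ (f : K[X]) (hf : f.coeff 0 = 1) (u : (FractionRing (AddMonoidAlgebra K S))ˣ),
      V = invertibleToV _ (toPrincipalIdeal _ _ u * contractedUnit hS f hf) := by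
  obtain ⟨x, hx, y, hy, r, hr, hr0⟩ := exists_mul_coeff_zero_ne_zero hm hS V
  have hy0 : y ≠ 0 := by
    rintro rfl
    rw [mul_zero, map_eq_zero_iff _ (IsFractionRing.injective _ _)] at hr
    rw [hr] at hr0
    simp at hr0
  have hle : FractionalIdeal.spanSingleton (AddMonoidAlgebra K S)⁰ y *
      (V : FractionalVIdeal (AddMonoidAlgebra K S)).toFractionalIdeal ≤ 1 := by
    rw [mul_comm]
    exact (mul_le_mul_right (FractionalIdeal.spanSingleton_le_iff_mem.2 hy) _).trans
      V.mul_inv_le_one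
  obtain ⟨J, hJ⟩ := FractionalIdeal.le_one_iff_exists_coeIdeal.1 hle
  have hrJ : r ∈ J := by
    have h1 : algebraMap _ (FractionRing (AddMonoidAlgebra K S)) r ∈
        (J : FractionalIdeal (AddMonoidAlgebra K S)⁰ (FractionRing (AddMonoidAlgebra K S))) := by
      rw [hJ, hr, mul_comm x y]
      exact FractionalIdeal.mul_mem_mul (FractionalIdeal.mem_spanSingleton_self _ _) hx
    obtain ⟨r', hr', h⟩ := (FractionalIdeal.mem_coeIdeal _).1 h1
    rwa [← IsFractionRing.injective _ _ h]
  obtain ⟨f, hf, rfl⟩ := exists_eq_contractedIdeal hS hrJ hr0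
  refine ⟨f, hf, (Units.mk0 y hy0)⁻¹, VInvertibleVIdeal.ext_toFractionalIdeal ?_⟩
  rw [toFractionalIdeal_invertibleToV, Units.val_mul, coe_contractedUnit, hJ,
    coe_toPrincipalIdeal, ← mul_assoc, FractionalIdeal.spanSingleton_mul_spanSingleton,
    Units.val_inv_eq_inv_val, Units.val_mk0, inv_mul_cancel₀ hy0, FractionalIdeal.spanSingleton_one,
    one_mul]

theorem picToVClassGroup_bijective (hm : 1 ≤ m) (hS : (S : Set ℕ)ᶜ = Set.Icc 1 m) :
    Function.Bijective (picToVClassGroup (AddMonoidAlgebra K S)) := by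
  refine ⟨picToVClassGroup_injective, fun c => ?_⟩
  induction c using QuotientGroup.induction_on with
  | H V =>
    obtain ⟨f, hf, u, rfl⟩ := exists_eq_invertibleToV hm hS V
    exact ⟨_, picToVClassGroup_mk _⟩

theorem exists_eq_contractedClass (hm : 1 ≤ m) (hS : (S : Set ℕ)ᶜ = Set.Icc 1 m)
    (c : VClassGroup (AddMonoidAlgebra K S)) :
    ∃ (f : K[X]) (hf : f.coeff 0 = 1), c = contractedClass hS f hf := by
  induction c using QuotientGroup.induction_on with
  | H V =>
    obtain ⟨f, hf, u, rfl⟩ := exists_eq_invertibleToV hm hS V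
    refine ⟨f, hf, ?_⟩
    change VClassGroup.mk _ = _
    rw [map_mul, map_mul, VClassGroup.mk_invertibleToV_eq_one_iff.2 ⟨u, rfl⟩, one_mul]
    rfl

/-- The homomorphism from `𝒞` to the `v`-class group that sends `p` to the class of
`pK[X] ∩ K[S]`. -/
noncomputable def truncatedPolyToVClassGroup (hS : (S : Set ℕ)ᶜ = Set.Icc 1 m) :
    TruncatedPoly K m →* VClassGroup (AddMonoidAlgebra K S) where
  toFun p := contractedClass hS p.1 p.2.1
  map_one' := (contractedClass_eq_one_iff hS _).2 ⟨1, map_one _⟩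
  map_mul' p q := by
    rw [contractedClass_mul]
    refine contractedClass_congr hS _ _ ?_
    ext j
    rw [coeff_truncatePoly, coeff_truncatePoly, TruncatedPoly.coeff_mul]
    split_ifs <;> rfl

theorem truncatedPolyToVClassGroup_ofPoly (hS : (S : Set ℕ)ᶜ = Set.Icc 1 m) {f : K[X]}
    (hf : f.coeff 0 = 1) :
    truncatedPolyToVClassGroup hS (TruncatedPoly.ofPoly m f hf) = contractedClass hS f hf := by
  refine contractedClass_congr hS _ hf ?_
  ext j
  rw [coeff_truncatePoly, coeff_truncatePoly]
  split_ifs with hj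
  · exact (coeff_truncatePoly m f j).trans (if_pos hj)
  · rfl

theorem truncatedPolyToVClassGroup_bijective (hm : 1 ≤ m) (hS : (S : Set ℕ)ᶜ = Set.Icc 1 m) :
    Function.Bijective (truncatedPolyToVClassGroup (K := K) hS) := by
  constructor
  · rw [injective_iff_map_eq_one]
    intro p hp
    obtain ⟨r, hr⟩ := (contractedClass_eq_one_iff hS p.2.1).1 hp
    ext j hj
    change p.1.coeff j = (1 : K[X]).coeff j
    rcases Nat.eq_zero_or_pos j with rfl | h0
    · simp [p.2.1]
    · rw [← hr, coeff_monoidAlgebraToPolynomial_of_notMem r j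
        ((notMem_iff_of_compl_eq_Icc hS).2 ⟨h0, hj⟩), Polynomial.coeff_one, if_neg h0.ne']
  · intro c
    obtain ⟨f, hf, rfl⟩ := exists_eq_contractedClass hm hS c
    exact ⟨_, truncatedPolyToVClassGroup_ofPoly hS hf⟩

/-- The isomorphism from the `v`-class group to `𝒞` that sends the class of `fK[X] ∩ K[S]` to the
truncation of `f`. -/
noncomputable def vClassGroupEquiv (hm : 1 ≤ m) (hS : (S : Set ℕ)ᶜ = Set.Icc 1 m) :
    VClassGroup (AddMonoidAlgebra K S) ≃* TruncatedPoly K m :=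
  (MulEquiv.ofBijective _ (truncatedPolyToVClassGroup_bijective hm hS)).symm

theorem vClassGroupEquiv_contractedClass (hm : 1 ≤ m) (hS : (S : Set ℕ)ᶜ = Set.Icc 1 m)
    {f : K[X]} (hf : f.coeff 0 = 1) :
    vClassGroupEquiv hm hS (contractedClass hS f hf) = TruncatedPoly.ofPoly m f hf := by
  rw [vClassGroupEquiv, MulEquiv.symm_apply_eq]
  exact (truncatedPolyToVClassGroup_ofPoly hS hf).symm

end Classes

/-! ### Prime divisors -/

section PrimeDivisors

variable {K : Type*} [Field K] {S : AddSubmonoid ℕ} {m : ℕ}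

/-- A prime ideal that is a `v`-invertible `v`-ideal contains an element with nonzero constant
term: otherwise `XP ⊆ P`, which is impossible as `X ∉ K[S]`. -/
theorem exists_mem_coeff_zero_ne_zero (hm : 1 ≤ m) (hS : (S : Set ℕ)ᶜ = Set.Icc 1 m)
    {P : Ideal (AddMonoidAlgebra K S)} (hP : P.IsPrime)
    {V : VInvertibleVIdeal (AddMonoidAlgebra K S)} (hV : V.IsIdeal P) :
    ∃ a ∈ P, (monoidAlgebraToPolynomial K S a).coeff 0 ≠ 0 := by
  by_contra! hcon
  obtain ⟨x, hx, y, hy, r, hr, hr0⟩ := exists_mul_coeff_zero_ne_zero hm hS V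
  obtain ⟨t, -, -, hmul⟩ := exists_fractionRing_X (K := K) hm hS
  rw [hV] at hx
  obtain ⟨a, ha, rfl⟩ := (FractionalIdeal.mem_coeIdeal _).1 hx
  obtain ⟨a', ha', hta⟩ := hmul a (hcon a ha)
  have haP : a' ∈ P := by
    -- `(Xa)^{m+1} = X^{m+1}a^m · a`
    obtain ⟨c, hc⟩ := exists_monoidAlgebraToPolynomial_eq_X_pow_mul (K := K) hS
      (monoidAlgebraToPolynomial K S a ^ m)
    have : a' ^ (m + 1) = c * a := by
      apply monoidAlgebraToPolynomial_injective
      rw [map_pow, map_mul, ha', hc]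
      ring
    exact hP.mem_of_pow_mem (m + 1) (this ▸ Ideal.mul_mem_left _ _ ha)
  have hmem : algebraMap _ (FractionRing (AddMonoidAlgebra K S)) a' * y ∈
      (1 : FractionalIdeal (AddMonoidAlgebra K S)⁰ (FractionRing (AddMonoidAlgebra K S))) := by
    refine V.mul_inv_le_one (FractionalIdeal.mul_mem_mul ?_ hy)
    rw [hV]
    exact FractionalIdeal.mem_coeIdeal_of_mem _ haP
  obtain ⟨s, hs⟩ := (FractionalIdeal.mem_one_iff _).1 hmem
  -- `s = Xr` has the nonzero coefficient `r(0)` at `X`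
  have hsr : monoidAlgebraToPolynomial K S (s * a) =
      monoidAlgebraToPolynomial K S (r * a') := by
    congr 1
    apply IsFractionRing.injective (AddMonoidAlgebra K S) (FractionRing (AddMonoidAlgebra K S))
    rw [map_mul, map_mul, hs, hr]
    ring
  have ha0 : monoidAlgebraToPolynomial K S a ≠ 0 := by
    rw [Ne, map_eq_zero_iff _ monoidAlgebraToPolynomial_injective]
    rintro rfl
    rw [map_zero, zero_mul, map_eq_zero_iff _ (IsFractionRing.injective _ _)] at hr
    rw [hr] at hr0
    simp at hr0
  have hsX : monoidAlgebraToPolynomial K S s =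
      monoidAlgebraToPolynomial K S r * Polynomial.X := by
    refine mul_right_cancel₀ ha0 ?_
    rw [← map_mul, hsr, map_mul, ha', mul_assoc]
  have h1 := coeff_monoidAlgebraToPolynomial_of_notMem s 1
    ((notMem_iff_of_compl_eq_Icc hS).2 ⟨le_rfl, hm⟩)
  rw [hsX, Polynomial.coeff_mul_X (n := 0)] at h1
  exact hr0 h1

theorem isPrime_contractedIdeal {f : K[X]} (hf : Irreducible f) :
    (contractedIdeal S f).IsPrime := by
  have : (Ideal.span {f}).IsPrime := (Ideal.span_singleton_prime hf.ne_zero).2 hf.prime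
  exact Ideal.IsPrime.comap _

/-- Multiplication by `X^{m+1}` moves any polynomial into `K[S]` and does not affect divisibility by
`f`, so that `f` inherits primality from `fK[X] ∩ K[S]`. -/
theorem irreducible_of_isPrime_contractedIdeal (hS : (S : Set ℕ)ᶜ = Set.Icc 1 m) {f : K[X]}
    (hf : f.coeff 0 = 1) (h : (contractedIdeal S f).IsPrime) : Irreducible f := by
  have key : ∀ a b : K[X], f ∣ a * b → f ∣ a ∨ f ∣ b := by
    intro a b hab
    obtain ⟨r, hr⟩ := exists_monoidAlgebraToPolynomial_eq_X_pow_mul hS a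
    obtain ⟨s, hs⟩ := exists_monoidAlgebraToPolynomial_eq_X_pow_mul hS b
    have hf0 : f.coeff 0 ≠ 0 := hf ▸ one_ne_zero
    have hrs : r * s ∈ contractedIdeal S f := by
      rw [mem_contractedIdeal, map_mul, hr, hs]
      obtain ⟨c, hc⟩ := hab
      exact ⟨Polynomial.X ^ (m + 1) * Polynomial.X ^ (m + 1) * c, by
        linear_combination Polynomial.X ^ (m + 1) * Polynomial.X ^ (m + 1) * hc⟩
    refine (h.mem_or_mem hrs).imp (fun h => ?_) (fun h => ?_)
    · exact dvd_of_dvd_X_pow_mul hf0 (hr ▸ mem_contractedIdeal.1 h)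
    · exact dvd_of_dvd_X_pow_mul hf0 (hs ▸ mem_contractedIdeal.1 h)
  refine Prime.irreducible ⟨?_, fun hu => h.ne_top ?_, key⟩
  · rintro rfl
    simp at hf
  · exact (Ideal.eq_top_iff_one _).2 (mem_contractedIdeal.2 hu.dvd)

theorem height_contractedIdeal (hS : (S : Set ℕ)ᶜ = Set.Icc 1 m) {f : K[X]}
    (hf : f.coeff 0 = 1) (hirr : Irreducible f) : (contractedIdeal S f).height = 1 := by
  have hP : (contractedIdeal S f).IsPrime := isPrime_contractedIdeal hirr
  have hf0 : f.coeff 0 ≠ 0 := hf ▸ one_ne_zero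
  refine le_antisymm ?_ (Order.one_le_iff_pos.2 (pos_iff_ne_zero.2 fun h => ?_))
  · refine (Ideal.height_le_iff (n := 1)).2 fun Q hQ hlt => ?_
    suffices Q = ⊥ by
      rw [this, Ideal.height_bot]
      exact zero_lt_one
    by_contra hne
    obtain ⟨q, hq, hq0⟩ := Submodule.exists_mem_ne_zero_of_ne_bot hne
    have hq0' : monoidAlgebraToPolynomial K S q ≠ 0 := by
      rwa [Ne, map_eq_zero_iff _ monoidAlgebraToPolynomial_injective]
    refine hlt.not_ge fun p hp => ?_
    -- write `q = f^k r` with `f ∤ r` and `p = fs`; then `p^k · X^{m+1}r = q · X^{m+1}s^k ∈ Q`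
    obtain ⟨k, r, hr, hqr⟩ := WfDvdMonoid.max_power_factor hq0' hirr
    obtain ⟨s, hs⟩ := mem_contractedIdeal.1 hp
    obtain ⟨u, hu⟩ := exists_monoidAlgebraToPolynomial_eq_X_pow_mul hS r
    obtain ⟨v, hv⟩ := exists_monoidAlgebraToPolynomial_eq_X_pow_mul hS (s ^ k)
    have h1 : p ^ k * u = q * v := by
      apply monoidAlgebraToPolynomial_injective
      rw [map_mul, map_mul, map_pow, hs, hu, hv, hqr]
      ring
    have h2 : u ∉ Q := fun h =>
      hr (dvd_of_dvd_X_pow_mul hf0 (hu ▸ mem_contractedIdeal.1 (hlt.le h)))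
    have h3 : p ^ k * u ∈ Q := h1 ▸ Ideal.mul_mem_right _ _ hq
    exact hQ.mem_of_pow_mem k ((hQ.mem_or_mem h3).resolve_right h2)
  · rw [Ideal.height_eq_zero_iff_eq_bot] at h
    obtain ⟨a, ha, ha0⟩ := exists_mem_contractedIdeal hS hf
    rw [h, Ideal.mem_bot] at ha
    rw [ha] at ha0
    simp at ha0

/-- The prime divisors in the class `c` are the ideals `fK[X] ∩ K[S]` with `f` irreducible,
`f(0) = 1` and truncation given by `c`. -/
theorem bijOn_contractedIdeal_primeDivisorsIn (hm : 1 ≤ m) (hS : (S : Set ℕ)ᶜ = Set.Icc 1 m)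
    (c : VClassGroup (AddMonoidAlgebra K S)) :
    Set.BijOn (contractedIdeal S)
      {f : K[X] | Irreducible f ∧ ∃ hf : f.coeff 0 = 1,
        TruncatedPoly.ofPoly m f hf = vClassGroupEquiv hm hS c} (primeDivisorsIn c) := by
  refine ⟨?_, fun f hf g hg h => contractedIdeal_injOn hS hf.2.1 hg.2.1 h, ?_⟩
  · rintro f ⟨hirr, hf, hc⟩
    refine ⟨isPrime_contractedIdeal hirr, height_contractedIdeal hS hf hirr, _,
      isIdeal_invertibleToV_contractedUnit hS f hf, (vClassGroupEquiv hm hS).injective ?_⟩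
    rw [← hc]
    exact vClassGroupEquiv_contractedClass hm hS hf
  · rintro P ⟨hP, -, V, hV, rfl⟩
    obtain ⟨a, ha, ha0⟩ := exists_mem_coeff_zero_ne_zero hm hS hP hV
    obtain ⟨f, hf, rfl⟩ := exists_eq_contractedIdeal hS ha ha0
    refine ⟨f, ⟨irreducible_of_isPrime_contractedIdeal hS hf hP, hf, ?_⟩, rfl⟩
    rw [hV.eq_invertibleToV hS hf]
    exact (vClassGroupEquiv_contractedClass hm hS hf).symm

end PrimeDivisors

/-! ### Irreducible polynomials with prescribed initial coefficients -/

section Irreducibles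

variable {K : Type*} [Field K] {m : ℕ}

/-- Dividing by the constant term is a bijection from the irreducible polynomials with initial
coefficients `a₀, …, a_m`, where `a₀ ≠ 0`, onto the irreducible polynomials with constant term `1`
and truncation `a₀⁻¹ ∑ aᵢXⁱ`. -/
theorem exists_bijOn_irreducible (a : Fin (m + 1) → K) (ha : a 0 ≠ 0) :
    ∃ (p : TruncatedPoly K m) (σ : K[X] → K[X]),
      Set.BijOn σ {f : K[X] | Irreducible f ∧ ∀ i : Fin (m + 1), f.coeff i = a i}
        {f : K[X] | Irreducible f ∧ ∃ hf : f.coeff 0 = 1, TruncatedPoly.ofPoly m f hf = p} := by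
  set q : K[X] := ∑ i : Fin (m + 1), Polynomial.monomial (i : ℕ) ((a 0)⁻¹ * a i) with hq
  have hqc : ∀ i : Fin (m + 1), q.coeff i = (a 0)⁻¹ * a i := by
    intro i
    simp [hq, Polynomial.coeff_monomial, Fin.val_inj]
  have hq0 : q.coeff 0 = 1 := by
    have := hqc 0
    rwa [Fin.val_zero, inv_mul_cancel₀ ha] at this
  have hunit : IsUnit (Polynomial.C (a 0)⁻¹) :=
    Polynomial.isUnit_C.2 (IsUnit.mk0 _ (inv_ne_zero ha))
  have hunit' : IsUnit (Polynomial.C (a 0)) := Polynomial.isUnit_C.2 (IsUnit.mk0 _ ha)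
  refine ⟨TruncatedPoly.ofPoly m q hq0, fun f => Polynomial.C (a 0)⁻¹ * f, ?_, ?_, ?_⟩
  · rintro f ⟨hirr, hf⟩
    have hf0 : (Polynomial.C (a 0)⁻¹ * f).coeff 0 = 1 := by
      have := hf 0
      rw [Fin.val_zero] at this
      rw [Polynomial.coeff_C_mul, this, inv_mul_cancel₀ ha]
    refine ⟨(irreducible_isUnit_mul hunit).2 hirr, hf0, ?_⟩
    ext j hj
    change (truncatePoly m _).coeff j = (truncatePoly m _).coeff j
    rw [coeff_truncatePoly, coeff_truncatePoly, if_pos hj, if_pos hj, Polynomial.coeff_C_mul,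
      hf ⟨j, Nat.lt_succ_of_le hj⟩, hqc ⟨j, Nat.lt_succ_of_le hj⟩]
  · intro f _ g _ h
    exact mul_left_cancel₀ hunit.ne_zero h
  · rintro f ⟨hirr, hf, h⟩
    refine ⟨Polynomial.C (a 0) * f, ⟨(irreducible_isUnit_mul hunit').2 hirr, fun i => ?_⟩, ?_⟩
    · have h1 := congrArg (fun p : TruncatedPoly K m => p.1.coeff i) h
      change (truncatePoly m _).coeff _ = (truncatePoly m _).coeff _ at h1
      rw [coeff_truncatePoly, coeff_truncatePoly, if_pos (Nat.lt_succ_iff.1 i.2),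
        if_pos (Nat.lt_succ_iff.1 i.2), hqc] at h1
      rw [Polynomial.coeff_C_mul, h1, mul_inv_cancel_left₀ ha]
    · change Polynomial.C (a 0)⁻¹ * (Polynomial.C (a 0) * f) = f
      rw [← mul_assoc, ← Polynomial.C_mul, inv_mul_cancel₀ ha, Polynomial.C_1, one_mul]

theorem setOf_irreducible_coeff_eq (p : TruncatedPoly K m) :
    {f : K[X] | Irreducible f ∧ ∀ i : Fin (m + 1), f.coeff i = p.1.coeff i} =
      {f : K[X] | Irreducible f ∧ ∃ hf : f.coeff 0 = 1, TruncatedPoly.ofPoly m f hf = p} := by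
  ext f
  refine and_congr_right fun _ => ⟨fun h => ⟨(h 0).trans p.2.1, ?_⟩, ?_⟩
  · ext j hj
    exact (coeff_truncatePoly m f j).trans ((if_pos hj).trans (h ⟨j, Nat.lt_succ_of_le hj⟩))
  · rintro ⟨hf, rfl⟩ i
    exact ((coeff_truncatePoly m f i).trans (if_pos (Nat.lt_succ_iff.1 i.2))).symm

end Irreducibles

/-! ### The class group and the prime divisors of `K[S]` -/

theorem mainTheorem4 {K : Type*} [Field K] (m : ℕ) (hm : 1 ≤ m) (S : AddSubmonoid ℕ)
    (hS : (S : Set ℕ)ᶜ = Set.Icc 1 m) :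
    -- `Pic(K[S]) = C_v(K[S])`
    Function.Bijective (picToVClassGroup (AddMonoidAlgebra K S)) ∧
    (∃ φ : VClassGroup (AddMonoidAlgebra K S) ≃* TruncatedPoly K m,
      (∀ (f : K[X]) (hf : f.coeff 0 = 1),
        -- the ideal `fK[X] ∩ K[S]` is a `v`-invertible `v`-ideal that meets `Reg(K[S])`
        (∃ V : VInvertibleVIdeal (AddMonoidAlgebra K S), V.IsIdeal (contractedIdeal S f)) ∧
        ((contractedIdeal S f : Set (AddMonoidAlgebra K S)) ∩
          regularElements (AddMonoidAlgebra K S)).Nonempty ∧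
        -- `φ` sends the class given by `fK[X] ∩ Reg(K[S])` to the truncation of `f`
        (∀ (V : VInvertibleVIdeal (AddMonoidAlgebra K S)) (J : Ideal (AddMonoidAlgebra K S)),
          V.IsIdeal J →
          (J : Set (AddMonoidAlgebra K S)) ∩ regularElements (AddMonoidAlgebra K S) =
            (contractedIdeal S f : Set (AddMonoidAlgebra K S)) ∩
              regularElements (AddMonoidAlgebra K S) →
          φ (VClassGroup.mk V) = TruncatedPoly.ofPoly m f hf)) ∧
      -- prime divisors in a class and irreducible polynomials
      (∀ c : VClassGroup (AddMonoidAlgebra K S),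
        Set.BijOn (contractedIdeal S)
          {f : K[X] | Irreducible f ∧ ∃ hf : f.coeff 0 = 1, TruncatedPoly.ofPoly m f hf = φ c}
          (primeDivisorsIn c))) ∧
    -- existence of prime divisors in all classes
    ((∀ c : VClassGroup (AddMonoidAlgebra K S), (primeDivisorsIn c).Nonempty) ↔
      ∀ a : Fin (m + 1) → K, a 0 ≠ 0 →
        {f : K[X] | Irreducible f ∧ ∀ i : Fin (m + 1), f.coeff i = a i}.Nonempty) ∧
    -- existence of infinitely many prime divisors in all classes
    ((∀ c : VClassGroup (AddMonoidAlgebra K S), (primeDivisorsIn c).Infinite) ↔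
      ∀ a : Fin (m + 1) → K, a 0 ≠ 0 →
        {f : K[X] | Irreducible f ∧ ∀ i : Fin (m + 1), f.coeff i = a i}.Infinite) := by
  set ψ := vClassGroupEquiv (K := K) hm hS with hψ
  have hbij := bijOn_contractedIdeal_primeDivisorsIn (K := K) hm hS
  refine ⟨picToVClassGroup_bijective hm hS, ⟨ψ, fun f hf => ⟨⟨_,
    isIdeal_invertibleToV_contractedUnit hS f hf⟩, ?_, fun V J hV hJ => ?_⟩, hbij⟩, ?_, ?_⟩
  · exact nonempty_contractedIdeal_inter_regularElements hm hS hf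
  · obtain rfl := eq_of_inter_regularElements_eq hm hS
      (nonempty_contractedIdeal_inter_regularElements hm hS hf) hJ
    rw [hV.eq_invertibleToV hS hf]
    exact vClassGroupEquiv_contractedClass hm hS hf
  · constructor
    · intro h a ha
      obtain ⟨p, σ, hσ⟩ := exists_bijOn_irreducible a ha
      have h1 := h (ψ.symm p)
      rw [← (hbij _).image_eq, Set.image_nonempty, ← hψ, ψ.apply_symm_apply, ← hσ.image_eq,
        Set.image_nonempty] at h1
      exact h1
    · intro h c
      rw [← (hbij c).image_eq, Set.image_nonempty, ← setOf_irreducible_coeff_eq]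
      exact h _ (by rw [Fin.val_zero, (vClassGroupEquiv hm hS c).2.1]; exact one_ne_zero)
  · constructor
    · intro h a ha
      obtain ⟨p, σ, hσ⟩ := exists_bijOn_irreducible a ha
      have h1 := h (ψ.symm p)
      rw [← (hbij _).image_eq, Set.infinite_image_iff (hbij _).injOn, ← hψ, ψ.apply_symm_apply,
        ← hσ.image_eq, Set.infinite_image_iff hσ.injOn] at h1
      exact h1
    · intro h c
      rw [← (hbij c).image_eq, Set.infinite_image_iff (hbij c).injOn,
        ← setOf_irreducible_coeff_eq]
      exact h _ (by rw [Fin.val_zero, (vClassGroupEquiv hm hS c).2.1]; exact one_ne_zero)
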